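/- Throughout, $\triangle_N\subset\mathbb R^N$ is the probability simplex and $\Omega:\triangle_N\to\mathbb R$ is a generalized negentropy: $\Omega(e_i)=0$ for every one-hot vector $e_i$, $\Omega$ is strictly convex, and $\Omega$ is invariant under permutations of the coordinates. Its Fenchel–Young loss is $L_\Omega(\theta,y)=\Omega(y)+\Omega^*(\theta)-\theta^\top y$ with $\Omega^*(\theta)=\sup_{y\in\triangle_N}(\theta^\top y-\Omega(y))$. We assume that $L_\Omega$ has margin $m\ge 0$, i.e. for all $\theta\in\mathbb R^N$ and all $i$, $L_\Omega(\theta,e_i)=0\iff\theta_i-\max_{j\ne i}\theta_j\ge m$. For $\beta>0$ and patterns $x_1,\dots,x_N\in\mathbb R^D$, the rows of $X\in\mathbb R^{N\times D}$, the Hopfield–Fenchel–Young (HFY) network iterates $q^{(t+1)}=X^\top\hat y_\Omega(\beta Xq^{(t)})$, where $\hat y_\Omega(\theta)=\operatorname{argmax}_{y\in\triangle_N}\theta^\top y-\Omega(y)$. It *stores and exactly retrieves the patterns in one iteration under an $\epsilon$-perturbation* if the patterns are distinct and, for every $i$ and every $q^{(0)}$ with $\|q^{(0)}-x_i\|\le\epsilon$,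 we have $q^{(T)}=x_i$ for all $T\ge1$. Let $M>0$ and let $D\ge 1$. **Proposition 3 (Storage capacity with exact retrieval).** 1. If the patterns lie on the sphere of radius $M$ about the origin with pairwise angles at least $\pi/3$, and $M^2>2m\beta^{-1}$ and $$\epsilon\le\frac M4-\frac{m}{2\beta M},$$ then the HFY network stores and exactly retrieves them in one iteration under an $\epsilon$-perturbation. The number of such patterns can be exponential in $D$: there is a universal constant $c>0$ such that for every $D\ge1$ and $M>0$ there exist $N\ge c\,(2/\sqrt3)^D$ points on the sphere of radius $M$ in $\mathbb R^D$ with pairwise angles at least $\pi/3$. 2. There is a universal constant $c>0$ such that the following holds for all $p\in[0,1]$ and $\zeta>0$. If the $N$ patterns are independent and uniformly distributed on the sphere of radius $M$, where $$N\le c\,\sqrt p\,\zeta^{\frac{D-1}2},\qquad \epsilon\le\frac M2\Bigl(1-\cos\frac1\zeta\Bigr)-\frac{m}{2\beta M},$$ then with probability at least $1-p$ the HFY network stores and exactly retrieves the patterns in one iteration under an $\epsilon$-perturbation. -/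

import Mathlib

open MeasureTheory ProbabilityTheory

noncomputable section

namespace HFY

/-- A generalized negentropy on the probability simplex `△_N`: zero at one-hot vectors, strictly
convex and permutation-invariant. A regularizer is a total function `(Fin N → ℝ) → ℝ` that is only
ever evaluated on the simplex, which is its domain (it stands for `Ω + I_{△_N}`). -/
structure IsGeneralizedNegentropy {N : ℕ} (Ω : (Fin N → ℝ) → ℝ) : Prop where
  zero_oneHot : ∀ i : Fin N, Ω (Pi.single i 1) = 0
  strictConvexOn : StrictConvexOn ℝ (stdSimplex ℝ (Fin N)) Ω
  perm_invariant : ∀ σ : Equiv.Perm (Fin N), ∀ y ∈ stdSimplex ℝ (Fin N), Ω (y ∘ σ) = Ω y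

/-- The Fenchel conjugate `Ω*(θ) = sup_{y ∈ △_N} θᵀy - Ω(y)`. A generalized negentropy is bounded
below by its value at the uniform distribution, so the supremum is that of a bounded set. -/
def fenchelConjugate {N : ℕ} (Ω : (Fin N → ℝ) → ℝ) (θ : Fin N → ℝ) : ℝ :=
  ⨆ y : stdSimplex ℝ (Fin N), (θ ⬝ᵥ y.1 - Ω y.1)

/-- The Fenchel-Young loss `L_Ω(θ, y) = Ω(y) + Ω*(θ) - θᵀy`. -/
def fenchelYoungLoss {N : ℕ} (Ω : (Fin N → ℝ) → ℝ) (θ y : Fin N → ℝ) : ℝ :=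
  Ω y + fenchelConjugate Ω θ - θ ⬝ᵥ y

/-- `L_Ω` has margin `m ≥ 0`: `L_Ω(θ, e_i) = 0 ↔ θ_i - max_{j ≠ i} θ_j ≥ m`.
For `N ≥ 2` at most one `m` satisfies this, so it is automatically the smallest one. -/
def HasMargin {N : ℕ} (Ω : (Fin N → ℝ) → ℝ) (m : ℝ) : Prop :=
  0 ≤ m ∧ ∀ (θ : Fin N → ℝ) (i : Fin N),
    fenchelYoungLoss Ω θ (Pi.single i 1) = 0 ↔ ∀ j, j ≠ i → m ≤ θ i - θ j

/-- `y` maximizes `θᵀy - Ω(y)` over the simplex. -/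
def IsRegArgmax {N : ℕ} (Ω : (Fin N → ℝ) → ℝ) (θ y : Fin N → ℝ) : Prop :=
  y ∈ stdSimplex ℝ (Fin N) ∧ IsMaxOn (fun z => θ ⬝ᵥ z - Ω z) (stdSimplex ℝ (Fin N)) y

/-- The `Ω`-regularized argmax transformation `ŷ_Ω(θ) = argmax_{y ∈ △_N} θᵀy - Ω(y)`. By strict
convexity there is at most one maximizer (the value is arbitrary where there is none). -/
def regArgmax {N : ℕ} (Ω : (Fin N → ℝ) → ℝ) (θ : Fin N → ℝ) : Fin N → ℝ :=
  Classical.epsilon (IsRegArgmax Ω θ)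

/-- The update `q ↦ Xᵀ ŷ_Ω(β X q)` of the Hopfield-Fenchel-Young network, where the rows of `X` are
the patterns `x i`. -/
def update {N D : ℕ} (Ω : (Fin N → ℝ) → ℝ) (β : ℝ) (x : Fin N → EuclideanSpace ℝ (Fin D))
    (q : EuclideanSpace ℝ (Fin D)) : EuclideanSpace ℝ (Fin D) :=
  ∑ i, regArgmax Ω (fun j => β * inner ℝ (x j) q) i • x i

/-- Pattern `x i` is exactly retrieved for the query `q` within `T` iterations:
`q^{(T')} = x i` for all `T' ≥ T`. -/
def RetrievedWithin {N D : ℕ} (Ω : (Fin N → ℝ) → ℝ) (β : ℝ)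
    (x : Fin N → EuclideanSpace ℝ (Fin D)) (q : EuclideanSpace ℝ (Fin D)) (i : Fin N)
    (T : ℕ) : Prop :=
  ∀ T' ≥ T, (update Ω β x)^[T'] q = x i

/-- The network stores the `N` (distinct) patterns `x` and exactly retrieves each of them in one
iteration under an `ε`-perturbation. -/
def StoresInOneIteration {N D : ℕ} (Ω : (Fin N → ℝ) → ℝ) (β ε : ℝ)
    (x : Fin N → EuclideanSpace ℝ (Fin D)) : Prop :=
  Function.Injective x ∧
    ∀ (i : Fin N) (q : EuclideanSpace ℝ (Fin D)), ‖q - x i‖ ≤ ε → RetrievedWithin Ω β x q i 1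

/-- The patterns lie on the sphere of radius `M` about the origin and are separated by an angle of
at least `α`. -/
def IsSeparatedOnSphere {N D : ℕ} (M α : ℝ) (x : Fin N → EuclideanSpace ℝ (Fin D)) : Prop :=
  (∀ i, ‖x i‖ = M) ∧ ∀ i j, i ≠ j → α ≤ InnerProductGeometry.angle (x i) (x j)

/-- The uniform distribution on the sphere of radius `M` about the origin of `ℝ^D`: the normalized
surface measure of the unit sphere, scaled by `M`. -/
def uniformSphere (D : ℕ) (M : ℝ) : Measure (EuclideanSpace ℝ (Fin D)) :=
  (((volume : Measure (EuclideanSpace ℝ (Fin D))).toSphere Set.univ)⁻¹ •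
      (volume : Measure (EuclideanSpace ℝ (Fin D))).toSphere).map
    (fun u : Metric.sphere (0 : EuclideanSpace ℝ (Fin D)) 1 => M • (u : EuclideanSpace ℝ (Fin D)))

end HFY

end

/-!
If `a ≠ b` are patterns of norm `M` at an angle of at least `α`, a query `q` within `ε` of `a`
satisfies `⟪a, q⟫ - ⟪b, q⟫ ≥ M² (1 - cos α) - 2 M ε`. As soon as `β` times this is at least the
margin, the Fenchel-Young loss vanishes at the one-hot vector of `a`, which is then the unique
regularized argmax, and the network jumps to `a` and stays there.

How many patterns can be separated by an angle `α` is governed by the measure of a spherical cap.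
A cone of half-angle `α` in the unit ball of `ℝ^D` fits into a single ellipsoid, centred at `cos α`
on the axis, with semi-axis `1` along it and `sin α` across it. So a cap has probability at most
`(sin α) ^ (D - 1)`. Adding points greedily outside the caps around the previous ones yields at
least `(sin α) ^ (1 - D)` separated points, and a union bound over pairs shows that `N` random
points fail to be separated with probability at most `N² α ^ (D - 1)`.
-/

namespace HFY

open InnerProductGeometry Metric Module Real

section RegularizedArgmax

variable {N : ℕ} {Ω : (Fin N → ℝ) → ℝ} {θ y z : Fin N → ℝ}

/- Jensen's inequality bounds `f y` from below: the barycentre of the simplex is a convex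
combination of `y`, with a weight `1 / card ι` that does not depend on `y`, and of the vertices. -/
lemma bddBelow_image_stdSimplex_of_convexOn {ι : Type*} [Fintype ι] {f : (ι → ℝ) → ℝ}
    (hf : ConvexOn ℝ (stdSimplex ℝ ι) f) : BddBelow (f '' stdSimplex ℝ ι) := by
  classical
  set n : ℝ := (Fintype.card ι : ℝ)
  refine ⟨n * f (fun _ => n⁻¹) - ∑ i, |f (Pi.single i 1)|, ?_⟩
  rintro _ ⟨y, hy, rfl⟩
  have hy1 : ∀ i, y i ≤ 1 := fun i => (mem_Icc_of_mem_stdSimplex hy i).2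
  have hn : 0 < n := by
    have : Nonempty ι := by
      by_contra! hι
      simpa using hy.2
    exact Nat.cast_pos.2 Fintype.card_pos
  have hbary : n⁻¹ • y + ∑ i, (n⁻¹ * (1 - y i)) • Pi.single i (1 : ℝ) = fun _ => n⁻¹ := by
    ext j
    simp only [Pi.add_apply, Pi.smul_apply, smul_eq_mul, Finset.sum_apply, Pi.single_apply,
      mul_ite, mul_one, mul_zero, Finset.sum_ite_eq, Finset.mem_univ, ↓reduceIte]
    ring
  have hweights : n⁻¹ + ∑ i, n⁻¹ * (1 - y i) = 1 := by
    rw [← Finset.mul_sum, Finset.sum_sub_distrib, hy.2, Finset.sum_const, Finset.card_univ,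
      nsmul_one]
    field_simp
    ring
  have hjensen := hf.map_add_sum_le (t := Finset.univ)
    (fun i _ => mul_nonneg (inv_nonneg.2 hn.le) (sub_nonneg.2 (hy1 i))) hweights
    (fun i _ => single_mem_stdSimplex ℝ i) (inv_nonneg.2 hn.le) hy
  have hvertices : ∑ i, (1 - y i) * f (Pi.single i 1) ≤ ∑ i, |f (Pi.single i 1)| := by
    refine Finset.sum_le_sum fun i _ => ?_
    calc (1 - y i) * f (Pi.single i 1) ≤ (1 - y i) * |f (Pi.single i 1)| :=
          mul_le_mul_of_nonneg_left (le_abs_self _) (sub_nonneg.2 (hy1 i))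
      _ ≤ |f (Pi.single i 1)| :=
          mul_le_of_le_one_left (abs_nonneg _) (sub_le_self _ (hy.1 i))
  simp only [hbary, smul_eq_mul, mul_assoc, ← Finset.mul_sum, ← mul_add] at hjensen
  rw [le_inv_mul_iff₀ hn] at hjensen
  linarith

lemma bddAbove_range_dotProduct_sub (hΩ : ConvexOn ℝ (stdSimplex ℝ (Fin N)) Ω) (θ : Fin N → ℝ) :
    BddAbove (Set.range fun y : stdSimplex ℝ (Fin N) => θ ⬝ᵥ y.1 - Ω y.1) := by
  have hconvex : ConvexOn ℝ (stdSimplex ℝ (Fin N)) fun y => Ω y - θ ⬝ᵥ y :=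
    hΩ.sub ((dotProductBilin ℝ ℝ θ).concaveOn hΩ.1)
  obtain ⟨b, hb⟩ := bddBelow_image_stdSimplex_of_convexOn hconvex
  refine ⟨-b, ?_⟩
  rintro _ ⟨y, rfl⟩
  linarith [hb (Set.mem_image_of_mem _ y.2)]

lemma IsRegArgmax.eq (hΩ : StrictConvexOn ℝ (stdSimplex ℝ (Fin N)) Ω)
    (hy : IsRegArgmax Ω θ y) (hz : IsRegArgmax Ω θ z) : y = z := by
  have hconcave : StrictConcaveOn ℝ (stdSimplex ℝ (Fin N)) fun w => θ ⬝ᵥ w - Ω w :=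
    ((dotProductBilin ℝ ℝ θ).concaveOn hΩ.1).sub_strictConvexOn hΩ
  exact hconcave.eq_of_isMaxOn hy.2 hz.2 hy.1 hz.1

lemma IsRegArgmax.regArgmax_eq (hΩ : StrictConvexOn ℝ (stdSimplex ℝ (Fin N)) Ω)
    (hy : IsRegArgmax Ω θ y) : regArgmax Ω θ = y :=
  IsRegArgmax.eq hΩ (Classical.epsilon_spec ⟨y, hy⟩) hy

lemma isRegArgmax_of_fenchelYoungLoss_eq_zero (hΩ : ConvexOn ℝ (stdSimplex ℝ (Fin N)) Ω)
    (hy : y ∈ stdSimplex ℝ (Fin N)) (hloss : fenchelYoungLoss Ω θ y = 0) :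
    IsRegArgmax Ω θ y := by
  refine ⟨hy, fun z hz => ?_⟩
  calc θ ⬝ᵥ z - Ω z ≤ fenchelConjugate Ω θ :=
        le_ciSup (bddAbove_range_dotProduct_sub hΩ θ) ⟨z, hz⟩
    _ = θ ⬝ᵥ y - Ω y := by
        rw [fenchelYoungLoss] at hloss
        linarith

lemma HasMargin.regArgmax_eq_single {m : ℝ} {i : Fin N} (hm : HasMargin Ω m)
    (hΩ : StrictConvexOn ℝ (stdSimplex ℝ (Fin N)) Ω) (hθ : ∀ j, j ≠ i → m ≤ θ i - θ j) :
    regArgmax Ω θ = Pi.single i 1 :=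
  IsRegArgmax.regArgmax_eq hΩ <| isRegArgmax_of_fenchelYoungLoss_eq_zero hΩ.convexOn
    (single_mem_stdSimplex ℝ i) ((hm.2 θ i).2 hθ)

end RegularizedArgmax

section InnerProductSpace

variable {E : Type*} [NormedAddCommGroup E] [InnerProductSpace ℝ E]

lemma sub_norm_mul_norm_le_inner_sub_inner (a b q : E) :
    ‖a‖ ^ 2 - inner ℝ a b - ‖a - b‖ * ‖q - a‖ ≤ inner ℝ a q - inner ℝ b q := by
  have hcs : -(‖a - b‖ * ‖q - a‖) ≤ inner ℝ (a - b) (q - a) :=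
    (abs_le.1 (abs_real_inner_le_norm _ _)).1
  simp only [inner_sub_left, inner_sub_right, real_inner_self_eq_norm_sq,
    real_inner_comm a b] at hcs
  linarith

lemma inner_le_of_le_angle {x y : E} {α : ℝ} (hα : 0 ≤ α) (h : α ≤ angle x y) :
    inner ℝ x y ≤ ‖x‖ * ‖y‖ * cos α := by
  rw [← cos_angle_mul_norm_mul_norm, mul_comm]
  exact mul_le_mul_of_nonneg_left (cos_le_cos_of_nonneg_of_le_pi hα (angle_le_pi _ _) h)
    (by positivity)

lemma le_inner_of_angle_le {x y : E} {α : ℝ} (hα : α ≤ π) (h : angle x y ≤ α) :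
    ‖x‖ * ‖y‖ * cos α ≤ inner ℝ x y := by
  rw [← cos_angle_mul_norm_mul_norm, mul_comm]
  exact mul_le_mul_of_nonneg_right (cos_le_cos_of_nonneg_of_le_pi (angle_nonneg _ _) hα h)
    (by positivity)

lemma measurableSet_setOf_angle_lt [MeasurableSpace E] [OpensMeasurableSpace E]
    [SecondCountableTopology E] (α : ℝ) : MeasurableSet {z : E × E | angle z.1 z.2 < α} := by
  have hangle : Measurable fun z : E × E => angle z.1 z.2 := measurable_arccos.comp (by fun_prop)
  exact measurableSet_lt hangle measurable_const

end InnerProductSpace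

section Retrieval

variable {N D : ℕ} {Ω : (Fin N → ℝ) → ℝ} {M m α β ε : ℝ} {x : Fin N → EuclideanSpace ℝ (Fin D)}

lemma update_eq_of_margin_le (hΩ : StrictConvexOn ℝ (stdSimplex ℝ (Fin N)) Ω)
    (hm : HasMargin Ω m) {q : EuclideanSpace ℝ (Fin D)} {i : Fin N}
    (h : ∀ j, j ≠ i → m ≤ β * inner ℝ (x i) q - β * inner ℝ (x j) q) :
    update Ω β x q = x i := by
  rw [update, hm.regArgmax_eq_single hΩ h]
  simp [Pi.single_apply]

lemma storesInOneIteration_of_update_eq (hx : Function.Injective x)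
    (h : ∀ i q, ‖q - x i‖ ≤ ε → update Ω β x q = x i) : StoresInOneIteration Ω β ε x := by
  refine ⟨hx, fun i q hq T hT => ?_⟩
  obtain ⟨t, rfl⟩ := Nat.exists_eq_add_of_le' hT
  have hfixed : update Ω β x (x i) = x i :=
    h i (x i) (by simpa using (norm_nonneg _).trans hq)
  rw [Function.iterate_succ_apply, h i q hq, Function.iterate_fixed hfixed]

namespace IsSeparatedOnSphere

lemma injective (hx : IsSeparatedOnSphere M α x) (hM : 0 < M) (hα : 0 < α) :
    Function.Injective x := by
  intro i j hij
  by_contra hne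
  have hj : x j ≠ 0 := norm_ne_zero_iff.1 ((hx.1 j).trans_ne hM.ne')
  have hangle := hx.2 i j hne
  rw [hij, angle_self hj] at hangle
  exact hangle.not_gt hα

lemma le_inner_sub_inner (hx : IsSeparatedOnSphere M α x) (hα : 0 ≤ α)
    {q : EuclideanSpace ℝ (Fin D)} {i j : Fin N} (hq : ‖q - x i‖ ≤ ε) (hij : i ≠ j) :
    M ^ 2 * (1 - cos α) - 2 * M * ε ≤ inner ℝ (x i) q - inner ℝ (x j) q := by
  have hinner : inner ℝ (x i) (x j) ≤ M ^ 2 * cos α := by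
    simpa only [hx.1, ← sq] using inner_le_of_le_angle hα (hx.2 i j hij)
  have hdist : ‖x i - x j‖ ≤ 2 * M := by
    simpa only [hx.1, ← two_mul] using norm_sub_le (x i) (x j)
  have hprod : ‖x i - x j‖ * ‖q - x i‖ ≤ 2 * M * ε :=
    mul_le_mul hdist hq (norm_nonneg _) ((norm_nonneg _).trans hdist)
  have hbound := sub_norm_mul_norm_le_inner_sub_inner (x i) (x j) q
  rw [hx.1] at hbound
  linarith

theorem storesInOneIteration (hx : IsSeparatedOnSphere M α x) (hM : 0 < M) (hα : 0 < α)
    (hβ : 0 < β) (hΩ : StrictConvexOn ℝ (stdSimplex ℝ (Fin N)) Ω) (hm : HasMargin Ω m)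
    (hε : ε ≤ M / 2 * (1 - cos α) - m / (2 * β * M)) : StoresInOneIteration Ω β ε x := by
  refine storesInOneIteration_of_update_eq (hx.injective hM hα) fun i q hq =>
    update_eq_of_margin_le hΩ hm fun j hj => ?_
  calc m = β * (M ^ 2 * (1 - cos α) -
        2 * M * (M / 2 * (1 - cos α) - m / (2 * β * M))) := by field_simp; ring
    _ ≤ β * (M ^ 2 * (1 - cos α) - 2 * M * ε) := by gcongr
    _ ≤ β * (inner ℝ (x i) q - inner ℝ (x j) q) :=
        mul_le_mul_of_nonneg_left (hx.le_inner_sub_inner hα.le hq hj.symm) hβ.le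
    _ = β * inner ℝ (x i) q - β * inner ℝ (x j) q := mul_sub _ _ _

lemma cons (hx : IsSeparatedOnSphere M α x) {u : EuclideanSpace ℝ (Fin D)} (hu : ‖u‖ = M)
    (hangle : ∀ i, α ≤ angle (x i) u) :
    IsSeparatedOnSphere M α (Fin.cons u x : Fin (N + 1) → EuclideanSpace ℝ (Fin D)) := by
  refine ⟨Fin.cases hu hx.1, Fin.cases (Fin.cases ?_ fun j _ => ?_) fun i =>
    Fin.cases (fun _ => hangle i) fun j hij => ?_⟩
  · exact fun h => absurd rfl h
  · exact (hangle j).trans_eq (angle_comm _ _)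
  · exact hx.2 i j fun h => hij (congrArg Fin.succ h)

end IsSeparatedOnSphere

end Retrieval

section Cone

variable {E : Type*} [NormedAddCommGroup E] [InnerProductSpace ℝ E] {e x : E} {α r : ℝ}

/-- The part inside the open unit ball of the open cone with axis `e` and half-angle `α`; it
relates the surface measure of a spherical cap to a volume. The angle with the apex `0` being
`π / 2`, the apex is left out when `α ≤ π / 2`. -/
def unitCone (e : E) (α : ℝ) : Set E := {x | ‖x‖ < 1 ∧ angle e x < α}

/-- For a unit vector `e` and `r ≠ 0`, the linear map that fixes `e` and multiplies the orthogonal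
complement of `e` by `r`; the ellipsoid covering a cone is the preimage of a ball under it. It is
written as a multiple of a transvection because Mathlib knows the determinant of the latter. -/
noncomputable def orthogonalDilation (e : E) (r : ℝ) : E →ₗ[ℝ] E :=
  r • LinearMap.transvection (innerₗ E e) ((r⁻¹ - 1) • e)

lemma orthogonalDilation_apply (e : E) (hr : r ≠ 0) (x : E) :
    orthogonalDilation e r x = r • x + ((1 - r) * inner ℝ e x) • e := by
  simp only [orthogonalDilation, LinearMap.smul_apply, LinearMap.transvection.apply,
    innerₗ_apply_apply, smul_add, smul_smul]
  congr 2
  field_simp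

lemma det_orthogonalDilation [FiniteDimensional ℝ E] (he : ‖e‖ = 1) (hr : r ≠ 0) :
    LinearMap.det (orthogonalDilation e r) = r ^ (finrank ℝ E - 1) := by
  have : Nontrivial E := ⟨e, 0, by rintro rfl; simp at he⟩
  rw [orthogonalDilation, LinearMap.det_smul, LinearMap.transvection.det, innerₗ_apply_apply,
    inner_smul_right, real_inner_self_eq_norm_sq, he, ← Nat.sub_add_cancel finrank_pos, pow_succ]
  simp [hr]

lemma norm_orthogonalDilation_sub_smul_sq (he : ‖e‖ = 1) (hr : r ≠ 0) (x : E) (c : ℝ) :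
    ‖orthogonalDilation e r x - c • e‖ ^ 2 =
      (inner ℝ e x - c) ^ 2 + r ^ 2 * (‖x‖ ^ 2 - inner ℝ e x ^ 2) := by
  rw [orthogonalDilation_apply e hr, add_sub_assoc, ← sub_smul, norm_add_sq_real, norm_smul,
    norm_smul, he, inner_smul_left, inner_smul_right, real_inner_comm, mul_pow, mul_pow,
    norm_eq_abs, norm_eq_abs, sq_abs, sq_abs, RCLike.conj_to_real]
  ring

lemma norm_le_of_mem_unitCone (he : ‖e‖ = 1) (hα : α ≤ π / 2) (hα₀ : 0 ≤ α)
    (hx : x ∈ unitCone e α) : ‖x‖ ≤ cos α * inner ℝ e x + sin α ^ 2 := by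
  have hcos : 0 ≤ cos α := cos_nonneg_of_mem_Icc ⟨by linarith, hα⟩
  have hinner : ‖x‖ * cos α ≤ inner ℝ e x := by
    simpa [he] using le_inner_of_angle_le (by linarith) hx.2.le
  calc ‖x‖ = cos α * (‖x‖ * cos α) + sin α ^ 2 * ‖x‖ := by
        linear_combination -‖x‖ * sin_sq_add_cos_sq α
    _ ≤ cos α * inner ℝ e x + sin α ^ 2 := by
        gcongr
        exact mul_le_of_le_one_right (sq_nonneg _) hx.1.le

lemma unitCone_subset_preimage_closedBall (he : ‖e‖ = 1) (hα₀ : 0 < α) (hα : α ≤ π / 2) :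
    unitCone e α ⊆ orthogonalDilation e (sin α)⁻¹ ⁻¹' closedBall (cos α • e) 1 := by
  intro x hx
  have hsin : 0 < sin α := sin_pos_of_pos_of_lt_pi hα₀ (by linarith [pi_pos])
  have hnorm : ‖x‖ ^ 2 ≤ (cos α * inner ℝ e x + sin α ^ 2) ^ 2 :=
    pow_le_pow_left₀ (norm_nonneg x) (norm_le_of_mem_unitCone he hα hα₀.le hx) 2
  rw [Set.mem_preimage, mem_closedBall_iff_norm, ← sq_le_one_iff₀ (norm_nonneg _),
    norm_orthogonalDilation_sub_smul_sq he (inv_ne_zero hsin.ne')]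
  calc (inner ℝ e x - cos α) ^ 2 + (sin α)⁻¹ ^ 2 * (‖x‖ ^ 2 - inner ℝ e x ^ 2)
      ≤ (inner ℝ e x - cos α) ^ 2 +
          (sin α)⁻¹ ^ 2 * ((cos α * inner ℝ e x + sin α ^ 2) ^ 2 - inner ℝ e x ^ 2) := by gcongr
    _ = 1 := by
        field_simp
        linear_combination
          (inner ℝ e x ^ 2 + sin α ^ 2) * sin_sq_add_cos_sq α

variable [FiniteDimensional ℝ E] [MeasurableSpace E] [BorelSpace E]
  (μ : Measure E) [μ.IsAddHaarMeasure]

lemma measure_unitCone_le_of_norm_eq_one (he : ‖e‖ = 1) (hα₀ : 0 < α) (hα : α ≤ π / 2) :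
    μ (unitCone e α) ≤ ENNReal.ofReal (sin α ^ (finrank ℝ E - 1)) * μ (ball 0 1) := by
  have hsin : 0 < sin α := sin_pos_of_pos_of_lt_pi hα₀ (by linarith [pi_pos])
  have hdet := det_orthogonalDilation he (inv_ne_zero hsin.ne')
  have hdet₀ : LinearMap.det (orthogonalDilation e (sin α)⁻¹) ≠ 0 := by
    rw [hdet]
    positivity
  calc μ (unitCone e α)
      ≤ μ (orthogonalDilation e (sin α)⁻¹ ⁻¹' closedBall (cos α • e) 1) :=
        measure_mono (unitCone_subset_preimage_closedBall he hα₀ hα)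
    _ = ENNReal.ofReal (sin α ^ (finrank ℝ E - 1)) * μ (ball 0 1) := by
        rw [Measure.addHaar_preimage_linearMap μ hdet₀, hdet, inv_pow, inv_inv,
          abs_of_pos (by positivity), Measure.addHaar_closedBall μ _ zero_le_one, one_pow,
          ENNReal.ofReal_one, one_mul]

lemma measure_unitCone_le (e : E) (hα₀ : 0 < α) (hα : α ≤ π / 2) :
    μ (unitCone e α) ≤ ENNReal.ofReal (sin α ^ (finrank ℝ E - 1)) * μ (ball 0 1) := by
  rcases eq_or_ne e 0 with rfl | he
  · have hempty : unitCone (0 : E) α = ∅ := by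
      simp [unitCone, hα.not_gt]
    simp [hempty]
  · have hnormalize : unitCone (‖e‖⁻¹ • e) α = unitCone e α := by
      simp [unitCone, angle_smul_left_of_pos _ _ (inv_pos.2 (norm_pos_iff.2 he))]
    rw [← hnormalize]
    exact measure_unitCone_le_of_norm_eq_one μ (norm_smul_inv_norm he) hα₀ hα

open scoped Pointwise in
lemma toSphere_angle_lt_le (e : E) (hα₀ : 0 < α) (hα : α ≤ π / 2) :
    μ.toSphere {u : sphere (0 : E) 1 | angle e u < α} ≤
      ENNReal.ofReal (sin α ^ (finrank ℝ E - 1)) * μ.toSphere Set.univ := by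
  have hmeas : MeasurableSet {u : sphere (0 : E) 1 | angle e u < α} :=
    (measurable_prodMk_left (x := e)).comp measurable_subtype_coe (measurableSet_setOf_angle_lt α)
  have hsector : Set.Ioo (0 : ℝ) 1 • ((↑) '' {u : sphere (0 : E) 1 | angle e u < α}) ⊆
      unitCone e α := by
    rintro _ ⟨t, ht, _, ⟨u, hu, rfl⟩, rfl⟩
    refine ⟨?_, (angle_smul_right_of_pos _ _ ht.1).trans_lt hu⟩
    simpa [norm_smul, abs_of_pos ht.1] using ht.2
  rw [Measure.toSphere_apply' _ hmeas, Measure.toSphere_apply_univ, mul_left_comm]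
  gcongr
  exact (measure_mono hsector).trans (measure_unitCone_le μ e hα₀ hα)

end Cone

section UniformSphere

variable {D : ℕ} {M α : ℝ}

lemma measurable_smul_coe_sphere (M : ℝ) :
    Measurable fun u : sphere (0 : EuclideanSpace ℝ (Fin D)) 1 =>
      M • (u : EuclideanSpace ℝ (Fin D)) := by
  fun_prop

lemma isProbabilityMeasure_uniformSphere (hD : 1 ≤ D) (M : ℝ) :
    IsProbabilityMeasure (uniformSphere D M) := by
  have : Nonempty (Fin D) := ⟨⟨0, hD⟩⟩
  have : NeZero (volume : Measure (EuclideanSpace ℝ (Fin D))).toSphere :=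
    ⟨Measure.toSphere_ne_zero _⟩
  exact Measure.isProbabilityMeasure_map (measurable_smul_coe_sphere M).aemeasurable

lemma ae_uniformSphere_norm_eq (hM : 0 ≤ M) : ∀ᵐ y ∂uniformSphere D M, ‖y‖ = M := by
  rw [uniformSphere, ae_map_iff (measurable_smul_coe_sphere M).aemeasurable
    (measurableSet_eq_fun measurable_norm measurable_const)]
  refine ae_of_all _ fun u => ?_
  simp [norm_smul, abs_of_nonneg hM]

lemma uniformSphere_angle_lt_le (hM : 0 < M) (a : EuclideanSpace ℝ (Fin D)) (hα₀ : 0 < α)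
    (hα : α ≤ π / 2) :
    uniformSphere D M {y | angle a y < α} ≤ ENNReal.ofReal (sin α ^ (D - 1)) := by
  have hmeas : MeasurableSet {y : EuclideanSpace ℝ (Fin D) | angle a y < α} :=
    measurable_prodMk_left (measurableSet_setOf_angle_lt α)
  rw [uniformSphere, Measure.map_apply (measurable_smul_coe_sphere M) hmeas,
    Measure.smul_apply, smul_eq_mul, Set.preimage_ofPred_eq]
  simp only [angle_smul_right_of_pos _ _ hM]
  set τ := (volume : Measure (EuclideanSpace ℝ (Fin D))).toSphere
  calc (τ Set.univ)⁻¹ * τ {u | angle a u < α}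
      ≤ (τ Set.univ)⁻¹ * (ENNReal.ofReal (sin α ^ (D - 1)) * τ Set.univ) := by
        gcongr
        simpa only [finrank_euclideanSpace_fin] using toSphere_angle_lt_le volume a hα₀ hα
    _ = ENNReal.ofReal (sin α ^ (D - 1)) * ((τ Set.univ)⁻¹ * τ Set.univ) := mul_left_comm _ _ _
    _ ≤ ENNReal.ofReal (sin α ^ (D - 1)) := mul_le_of_le_one_right' (ENNReal.inv_mul_le_one _)

end UniformSphere

section Packing

variable {D : ℕ} {M α : ℝ}

lemma exists_norm_eq_forall_le_angle {ι : Type*} [Fintype ι] (hD : 1 ≤ D) (hM : 0 < M)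
    (hα₀ : 0 < α) (hα : α ≤ π / 2) (hcard : Fintype.card ι * sin α ^ (D - 1) < 1)
    (x : ι → EuclideanSpace ℝ (Fin D)) :
    ∃ u : EuclideanSpace ℝ (Fin D), ‖u‖ = M ∧ ∀ i, α ≤ angle (x i) u := by
  have := isProbabilityMeasure_uniformSphere hD M
  by_contra! hcover
  have hae : Set.univ ≤ᵐ[uniformSphere D M] ⋃ i, {u | angle (x i) u < α} := by
    filter_upwards [ae_uniformSphere_norm_eq hM.le] with u hu _
    exact Set.mem_iUnion.2 (hcover u hu)
  have hone : (1 : ENNReal) < 1 :=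
    calc (1 : ENNReal) = uniformSphere D M Set.univ := measure_univ.symm
      _ ≤ uniformSphere D M (⋃ i, {u | angle (x i) u < α}) := measure_mono_ae hae
      _ ≤ ∑ i, uniformSphere D M {u | angle (x i) u < α} := measure_iUnion_fintype_le _ _
      _ ≤ ∑ _i : ι, ENNReal.ofReal (sin α ^ (D - 1)) :=
          Finset.sum_le_sum fun i _ => uniformSphere_angle_lt_le hM (x i) hα₀ hα
      _ = ENNReal.ofReal (Fintype.card ι * sin α ^ (D - 1)) := by
          rw [Finset.sum_const, Finset.card_univ, nsmul_eq_mul,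
            ENNReal.ofReal_mul (Nat.cast_nonneg _), ENNReal.ofReal_natCast]
      _ < 1 := ENNReal.ofReal_lt_one.2 hcard
  exact hone.false

lemma exists_isSeparatedOnSphere_of_lt (hD : 1 ≤ D) (hM : 0 < M) (hα₀ : 0 < α) (hα : α ≤ π / 2) :
    ∀ N : ℕ, (N : ℝ) < (sin α ^ (D - 1))⁻¹ + 1 →
      ∃ x : Fin N → EuclideanSpace ℝ (Fin D), IsSeparatedOnSphere M α x
  | 0, _ => ⟨Fin.elim0, fun i => i.elim0, fun i => i.elim0⟩
  | N + 1, hN => by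
    have hsin : 0 < sin α := sin_pos_of_pos_of_lt_pi hα₀ (by linarith [pi_pos])
    have hlt : (N : ℝ) < (sin α ^ (D - 1))⁻¹ := by
      push_cast at hN
      linarith
    obtain ⟨x, hx⟩ := exists_isSeparatedOnSphere_of_lt hD hM hα₀ hα N (by linarith)
    obtain ⟨u, hu, hangle⟩ := exists_norm_eq_forall_le_angle hD hM hα₀ hα
      (by rwa [Fintype.card_fin, ← lt_div_iff₀ (by positivity), one_div]) x
    exact ⟨_, hx.cons hu hangle⟩

theorem exists_isSeparatedOnSphere (hD : 1 ≤ D) (hM : 0 < M) (hα₀ : 0 < α) (hα : α ≤ π / 2) :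
    ∃ (N : ℕ) (x : Fin N → EuclideanSpace ℝ (Fin D)),
      (sin α ^ (D - 1))⁻¹ ≤ N ∧ IsSeparatedOnSphere M α x := by
  have hsin : 0 ≤ sin α := sin_nonneg_of_nonneg_of_le_pi hα₀.le (by linarith [pi_pos])
  obtain ⟨x, hx⟩ := exists_isSeparatedOnSphere_of_lt hD hM hα₀ hα _
    (Nat.ceil_lt_add_one (by positivity))
  exact ⟨_, x, Nat.le_ceil _, hx⟩

lemma exists_isSeparatedOnSphere_pi_div_three (hD : 1 ≤ D) (hM : 0 < M) :
    ∃ (N : ℕ) (x : Fin N → EuclideanSpace ℝ (Fin D)),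
      √3 / 2 * (2 / √3) ^ D ≤ N ∧ IsSeparatedOnSphere M (π / 3) x := by
  have hrate : √3 / 2 * (2 / √3) ^ D = (sin (π / 3) ^ (D - 1))⁻¹ := by
    obtain ⟨d, rfl⟩ := Nat.exists_eq_add_of_le' hD
    rw [sin_pi_div_three, Nat.add_sub_cancel, pow_succ, ← inv_pow, inv_div]
    field_simp
  rw [hrate]
  exact exists_isSeparatedOnSphere hD hM (by positivity) (by linarith [pi_pos])

end Packing

section RandomPatterns

variable {S : Type*} [MeasurableSpace S] {P : Measure S} [IsProbabilityMeasure P]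
  {D N : ℕ} {M α : ℝ}

lemma measure_prodMk_mem_le_of_indepFun {A B : Type*} [MeasurableSpace A] [MeasurableSpace B]
    {Y : S → A} {Z : S → B} {ν : Measure B} {s : Set (A × B)} {k : ENNReal}
    (hYZ : IndepFun Y Z P) (hY : AEMeasurable Y P) (hZ : HasLaw Z ν P) (hs : MeasurableSet s)
    (h : ∀ a, ν (Prod.mk a ⁻¹' s) ≤ k) : P {ω | (Y ω, Z ω) ∈ s} ≤ k := by
  have hYP : IsProbabilityMeasure (P.map Y) := Measure.isProbabilityMeasure_map hY
  have hνP : IsProbabilityMeasure ν := hZ.isProbabilityMeasure_iff.1 inferInstance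
  have hprod : HasLaw (fun ω => (Y ω, Z ω)) ((P.map Y).prod ν) P :=
    (indepFun_iff_hasLaw_prodMk_prod ⟨hY, rfl⟩ hZ).1 hYZ
  calc P {ω | (Y ω, Z ω) ∈ s} = (P.map Y).prod ν s := hprod.measure_eq hs
    _ = ∫⁻ a, ν (Prod.mk a ⁻¹' s) ∂P.map Y := Measure.prod_apply hs
    _ ≤ ∫⁻ _, k ∂P.map Y := lintegral_mono h
    _ = k := by simp

/- A cap of angular radius `α < 1` has probability at most `sin α ^ (D - 1)`, and for `1 ≤ α` the
bound is trivial. -/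
lemma measure_angle_lt_le_of_indepFun (hM : 0 < M) (hα : 0 < α)
    {Y Z : S → EuclideanSpace ℝ (Fin D)} (hYZ : IndepFun Y Z P) (hY : AEMeasurable Y P)
    (hZ : HasLaw Z (uniformSphere D M) P) :
    P {ω | angle (Y ω) (Z ω) < α} ≤ ENNReal.ofReal (α ^ (D - 1)) := by
  rcases le_total 1 α with h1 | h1
  · exact prob_le_one.trans (ENNReal.one_le_ofReal.2 (one_le_pow₀ h1))
  have hsin : 0 ≤ sin α := sin_nonneg_of_nonneg_of_le_pi hα.le (by linarith [pi_gt_three])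
  refine measure_prodMk_mem_le_of_indepFun hYZ hY hZ
    (measurableSet_setOf_angle_lt α) fun a => ?_
  calc uniformSphere D M {y | angle a y < α} ≤ ENNReal.ofReal (sin α ^ (D - 1)) :=
        uniformSphere_angle_lt_le hM a hα (by linarith [pi_gt_three])
    _ ≤ ENNReal.ofReal (α ^ (D - 1)) := by
        gcongr
        exact sin_le hα.le

lemma measure_not_isSeparatedOnSphere_le (hM : 0 < M) (hα : 0 < α)
    {X : Fin N → S → EuclideanSpace ℝ (Fin D)} (hX : Pairwise fun i j => IndepFun (X i) (X j) P)
    (hlaw : ∀ i, HasLaw (X i) (uniformSphere D M) P) :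
    P {ω | ¬ IsSeparatedOnSphere M α (fun i => X i ω)} ≤
      ENNReal.ofReal (N ^ 2 * α ^ (D - 1)) := by
  have hnorm : ∀ᵐ ω ∂P, ∀ i, ‖X i ω‖ = M := ae_all_iff.2 fun i =>
    ae_of_ae_map (hlaw i).aemeasurable ((hlaw i).map_eq ▸ ae_uniformSphere_norm_eq hM.le)
  have hclose : {ω | ¬ IsSeparatedOnSphere M α (fun i => X i ω)} ≤ᵐ[P]
      ⋃ z ∈ (Finset.univ : Finset (Fin N)).offDiag, {ω | angle (X z.1 ω) (X z.2 ω) < α} := by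
    filter_upwards [hnorm] with ω hω hnot
    obtain ⟨i, j, hij, hlt⟩ : ∃ i j, i ≠ j ∧ angle (X i ω) (X j ω) < α := by
      by_contra! hsep
      exact hnot ⟨hω, hsep⟩
    exact Set.mem_biUnion (x := (i, j)) (by simpa using hij) hlt
  have hcard : (Finset.univ : Finset (Fin N)).offDiag.card ≤ N ^ 2 := by
    simp [Finset.offDiag_card, sq]
  calc P {ω | ¬ IsSeparatedOnSphere M α (fun i => X i ω)}
      ≤ ∑ z ∈ (Finset.univ : Finset (Fin N)).offDiag, P {ω | angle (X z.1 ω) (X z.2 ω) < α} :=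
        (measure_mono_ae hclose).trans (measure_biUnion_finset_le _ _)
    _ ≤ ∑ _z ∈ (Finset.univ : Finset (Fin N)).offDiag, ENNReal.ofReal (α ^ (D - 1)) :=
        Finset.sum_le_sum fun z hz => measure_angle_lt_le_of_indepFun hM hα
          (hX (Finset.mem_offDiag.1 hz).2.2) (hlaw _).aemeasurable (hlaw _)
    _ ≤ (N ^ 2 : ℕ) * ENNReal.ofReal (α ^ (D - 1)) := by
        rw [Finset.sum_const, nsmul_eq_mul]
        gcongr
    _ = ENNReal.ofReal (N ^ 2 * α ^ (D - 1)) := by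
        rw [← ENNReal.ofReal_natCast, ← ENNReal.ofReal_mul (by positivity), Nat.cast_pow]

lemma sq_mul_one_div_pow_le_of_le_sqrt_mul_rpow {p ζ : ℝ} (hD : 1 ≤ D) (hp : 0 ≤ p) (hζ : 0 < ζ)
    (hN : (N : ℝ) ≤ √p * ζ ^ (((D : ℝ) - 1) / 2)) : (N : ℝ) ^ 2 * (1 / ζ) ^ (D - 1) ≤ p := by
  have hpow : (ζ ^ (((D : ℝ) - 1) / 2)) ^ 2 = ζ ^ (D - 1) := by
    rw [← rpow_mul_natCast hζ.le, ← rpow_natCast ζ (D - 1), Nat.cast_sub hD]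
    norm_num
  calc (N : ℝ) ^ 2 * (1 / ζ) ^ (D - 1)
      ≤ (√p * ζ ^ (((D : ℝ) - 1) / 2)) ^ 2 * (1 / ζ) ^ (D - 1) := by gcongr
    _ = p * (ζ * (1 / ζ)) ^ (D - 1) := by rw [mul_pow, hpow, sq_sqrt hp, mul_assoc, ← mul_pow]
    _ = p := by rw [mul_one_div_cancel hζ.ne', one_pow, mul_one]

theorem measure_not_storesInOneIteration_le {β m ε p ζ : ℝ} {Ω : (Fin N → ℝ) → ℝ}
    (hD : 1 ≤ D) (hM : 0 < M) (hβ : 0 < β) (hp : 0 ≤ p) (hζ : 0 < ζ)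
    (hΩ : StrictConvexOn ℝ (stdSimplex ℝ (Fin N)) Ω) (hm : HasMargin Ω m)
    (hε : ε ≤ M / 2 * (1 - cos (1 / ζ)) - m / (2 * β * M))
    (hN : (N : ℝ) ≤ √p * ζ ^ (((D : ℝ) - 1) / 2))
    {X : Fin N → S → EuclideanSpace ℝ (Fin D)} (hX : Pairwise fun i j => IndepFun (X i) (X j) P)
    (hlaw : ∀ i, HasLaw (X i) (uniformSphere D M) P) :
    P {ω | ¬ StoresInOneIteration Ω β ε (fun i => X i ω)} ≤ ENNReal.ofReal p := by
  have hα : 0 < 1 / ζ := one_div_pos.2 hζ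
  calc P {ω | ¬ StoresInOneIteration Ω β ε (fun i => X i ω)}
      ≤ P {ω | ¬ IsSeparatedOnSphere M (1 / ζ) (fun i => X i ω)} :=
        measure_mono fun ω hω hsep => hω (hsep.storesInOneIteration hM hα hβ hΩ hm hε)
    _ ≤ ENNReal.ofReal (N ^ 2 * (1 / ζ) ^ (D - 1)) :=
        measure_not_isSeparatedOnSphere_le hM hα hX hlaw
    _ ≤ ENNReal.ofReal p :=
        ENNReal.ofReal_le_ofReal (sq_mul_one_div_pow_le_of_le_sqrt_mul_rpow hD hp hζ hN)

end RandomPatterns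

end HFY

theorem proposition3_general :
    ((∀ (D N : ℕ) (M β m ε : ℝ) (Ω : (Fin N → ℝ) → ℝ) (x : Fin N → EuclideanSpace ℝ (Fin D)),
        0 < M → 0 < β →
        StrictConvexOn ℝ (stdSimplex ℝ (Fin N)) Ω → HFY.HasMargin Ω m →
        ε ≤ M / 4 - m / (2 * β * M) →
        HFY.IsSeparatedOnSphere M (Real.pi / 3) x →
        HFY.StoresInOneIteration Ω β ε x) ∧
      ∃ c : ℝ, 0 < c ∧ ∀ D : ℕ, 1 ≤ D → ∀ M : ℝ, 0 < M →
        ∃ (N : ℕ) (x : Fin N → EuclideanSpace ℝ (Fin D)),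
          c * (2 / √3) ^ D ≤ (N : ℝ) ∧ HFY.IsSeparatedOnSphere M (Real.pi / 3) x) ∧
    ∃ c : ℝ, 0 < c ∧
      ∀ (D N : ℕ) (M β m ε p ζ : ℝ) (Ω : (Fin N → ℝ) → ℝ),
        1 ≤ D → 0 < M → 0 < β → 0 ≤ p → 0 < ζ →
        StrictConvexOn ℝ (stdSimplex ℝ (Fin N)) Ω → HFY.HasMargin Ω m →
        ε ≤ M / 2 * (1 - Real.cos (1 / ζ)) - m / (2 * β * M) →
        (N : ℝ) ≤ c * (√p * ζ ^ (((D : ℝ) - 1) / 2)) →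
        ∀ (S : Type*) [MeasurableSpace S] (P : Measure S) [IsProbabilityMeasure P]
          (X : Fin N → S → EuclideanSpace ℝ (Fin D)),
          (Pairwise fun i j => IndepFun (X i) (X j) P) →
          (∀ i, HasLaw (X i) (HFY.uniformSphere D M) P) →
          P {ω | ¬ HFY.StoresInOneIteration Ω β ε (fun i => X i ω)} ≤ ENNReal.ofReal p := by
  refine ⟨⟨?_, √3 / 2, by positivity, fun D hD M hM =>
    HFY.exists_isSeparatedOnSphere_pi_div_three hD hM⟩, 1, one_pos, ?_⟩
  · intro D N M β m ε Ω x hM hβ hΩ hm hε hx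
    refine hx.storesInOneIteration hM (by positivity) hβ hΩ hm (hε.trans_eq ?_)
    rw [Real.cos_pi_div_three]
    ring
  · intro D N M β m ε p ζ Ω hD hM hβ hp hζ hΩ hm hε hN S _ P _ X hX hlaw
    rw [one_mul] at hN
    exact HFY.measure_not_storesInOneIteration_le hD hM hβ hp hζ hΩ hm hε hN hX hlaw

theorem proposition3 :
    -- patterns on the sphere of radius `M` with pairwise angles at least `π / 3`
    ((∀ (D N : ℕ) (M β m ε : ℝ) (Ω : (Fin N → ℝ) → ℝ) (x : Fin N → EuclideanSpace ℝ (Fin D)),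
        0 < M → 0 < β →
        HFY.IsGeneralizedNegentropy Ω → HFY.HasMargin Ω m →
        2 * m * β⁻¹ < M ^ 2 → ε ≤ M / 4 - m / (2 * β * M) →
        HFY.IsSeparatedOnSphere M (Real.pi / 3) x →
        HFY.StoresInOneIteration Ω β ε x) ∧
      ∃ c : ℝ, 0 < c ∧ ∀ D : ℕ, 1 ≤ D → ∀ M : ℝ, 0 < M →
        ∃ (N : ℕ) (x : Fin N → EuclideanSpace ℝ (Fin D)),
          c * (2 / √3) ^ D ≤ (N : ℝ) ∧ HFY.IsSeparatedOnSphere M (Real.pi / 3) x) ∧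
    -- independent patterns, uniformly distributed on the sphere of radius `M`;
    -- the failure event has (outer) probability at most `p`
    ∃ c : ℝ, 0 < c ∧
      ∀ (D N : ℕ) (M β m ε p ζ : ℝ) (Ω : (Fin N → ℝ) → ℝ),
        1 ≤ D → 0 < M → 0 < β → 0 ≤ p → p ≤ 1 → 0 < ζ →
        HFY.IsGeneralizedNegentropy Ω → HFY.HasMargin Ω m →
        ε ≤ M / 2 * (1 - Real.cos (1 / ζ)) - m / (2 * β * M) →
        (N : ℝ) ≤ c * (√p * ζ ^ (((D : ℝ) - 1) / 2)) →
        ∀ (S : Type*) [MeasurableSpace S] (P : Measure S) [IsProbabilityMeasure P]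
          (X : Fin N → S → EuclideanSpace ℝ (Fin D)),
          iIndepFun X P → (∀ i, HasLaw (X i) (HFY.uniformSphere D M) P) →
          P {ω | ¬ HFY.StoresInOneIteration Ω β ε (fun i => X i ω)} ≤ ENNReal.ofReal p := by
  obtain ⟨⟨hretrieval, hpacking⟩, c, hc, hrandom⟩ := proposition3_general
  exact ⟨⟨fun D N M β m ε Ω x hM hβ hΩ hm _ =>
    hretrieval D N M β m ε Ω x hM hβ hΩ.strictConvexOn hm, hpacking⟩, c, hc,
    fun D N M β m ε p ζ Ω hD hM hβ hp _ hζ hΩ hm hε hN S _ P _ X hX =>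
      hrandom D N M β m ε p ζ Ω hD hM hβ hp hζ hΩ.strictConvexOn hm hε hN S P X
        fun _ _ => hX.indepFun⟩
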